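/- Consider the following fading model. A reconfigurable intelligent surface (RIS) has $N\ge 1$ elements with reflection matrix $\Theta=\mathrm{diag}(\beta e^{j\theta_1},\dots,\beta e^{j\theta_N})$, $\beta\in(0,1]$. The links $\chi\in\{AR,JR,RB,RW\}$ (Alice-RIS, Jammer-RIS, RIS-Bob, RIS-Willie) have complex fading coefficients $h_{\chi,n}$, $1\le n\le N$, all mutually independent, with $|h_{\chi,n}|$ Nakagami distributed with parameter $m_\chi>0$ and unit second moment, i.e. with density $\frac{2m_\chi^{m_\chi}}{\Gamma(m_\chi)}x^{2m_\chi-1}e^{-m_\chi x^2}$ on $x>0$. Link $\chi$ has distance $d_\chi>0$ and path loss $L_\chi=d_\chi^{-\alpha_\chi}$; put $\mathcal L_1=L_{RB}L_{AR}$, $\mathcal L_2=L_{RW}L_{AR}$. The phases $\theta_n\in\mathbb R$ are chosen, measurably from case to case, so as to maximize $|\mathbf h_{RB}^T\Theta\mathbf h_{AR}|$. Let $P_t>0$ be the total power, $P_A=\kappa P_t$ Alice's power with $\kappa\in(0,1)$, $\sigma_B^2,\sigma_W^2>0$ the noise powers at Bob and Willie, $B>0$ the bandwidth, $\bar R>0$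 the target rate, which is also the switch threshold, and $\rho=P_t/\sigma_B^2$ the transmit SNR. The jammer's power is uniform on $[0,(1-\kappa)P_t]$ and independent of the fading, and its interference at Bob is cancelled completely. With $G_B=|\mathbf h_{RB}^T\Theta\mathbf h_{AR}|^2$ and $G_W=|\mathbf h_{RW}^T\Theta\mathbf h_{AR}|^2$, the secrecy rate is $$R_s=\Big[B\log_2\Big(1+\tfrac{P_tG_B\mathcal L_1}{\sigma_B^2}\Big)-B\log_2\Big(1+\tfrac{P_tG_W\mathcal L_2}{\sigma_W^2}\Big)\Big]^+$$ and the covert rate is $R_B^{CC}=B\log_2\big(1+\tfrac{P_AG_B\mathcal L_1}{\sigma_B^2}\big)$. In the joint secrecy and covert communication (JSACC) system Bob's rate is $R_s$ if $R_s\ge\bar R$ and $R_B^{CC}$ otherwise. Let $\mathbb P_1(\rho)$ be Bob's outage probability, i.e. the probability that his rate is less than $\bar R$, as a function of $\rho$ with all other parameters (including $\sigma_B^2,\sigma_W^2$) fixed. Then Bob has diversity order $\mathcal D_1=m_sN$, where $m_s=\min\{m_{AR},m_{RB}\}$; that is, $\mathbb P_1(\rho)>0$ for all large $\rho$ and $$\lim_{\rho\to\infty}-\frac{\log\mathbb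 P_1(\rho)}{\log\rho}=m_sN .$$ This holds both for $m_{AR}\ne m_{RB}$ and for $m_{AR}=m_{RB}$. It also holds when $G_W$ is replaced by its idealization $\beta^2Y$, with $Y$ exponentially distributed with mean $N$ and independent of $(h_{AR,n},h_{RB,n})_{1\le n\le N}$. -/

import Mathlib

open MeasureTheory ProbabilityTheory Filter Topology

noncomputable section

namespace JSACC

/-- Density of the Nakagami distribution with shape `m` and spread `w` (the second moment):
`2 m ^ m / (Γ(m) w ^ m) * x ^ (2 m - 1) * exp (-m x ^ 2 / w)` on `x > 0`. -/
def nakagamiPDF (m w x : ℝ) : ℝ :=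
  if 0 < x then
    2 * m ^ m / (Real.Gamma m * w ^ m) * x ^ (2 * m - 1) * Real.exp (-(m / w) * x ^ 2)
  else 0

/-- The Nakagami distribution with shape `m` and spread `w`, as a measure on `ℝ`. -/
def nakagamiMeasure (m w : ℝ) : Measure ℝ :=
  volume.withDensity fun x => ENNReal.ofReal (nakagamiPDF m w x)

/-- The four links: Alice-RIS, Jammer-RIS, RIS-Bob, RIS-Willie. -/
inductive Link : Type
  | AR
  | JR
  | RB
  | RW

/-- The deterministic parameters of the system. -/
structure Params where
  /-- number of reflecting elements of the RIS -/
  N : ℕ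
  /-- bandwidth -/
  B : ℝ
  /-- target rate, which is also the switch threshold -/
  Rbar : ℝ
  /-- power allocation: Alice's power is `κ * Pt` -/
  κ : ℝ
  /-- common amplitude coefficient of the reflecting elements -/
  β : ℝ
  /-- noise standard deviation at Bob -/
  σB : ℝ
  /-- noise standard deviation at Willie -/
  σW : ℝ
  /-- distance of each link -/
  d : Link → ℝ
  /-- path-loss exponent of each link -/
  α : Link → ℝ
  /-- Nakagami fading parameter of each link -/
  m : Link → ℝ
  N_pos : 1 ≤ N
  B_pos : 0 < B
  Rbar_pos : 0 < Rbar
  κ_pos : 0 < κ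
  κ_lt_one : κ < 1
  β_pos : 0 < β
  β_le_one : β ≤ 1
  σB_pos : 0 < σB
  σW_pos : 0 < σW
  d_pos : ∀ χ, 0 < d χ
  m_pos : ∀ χ, 0 < m χ

/-- Path loss of a link, `d ^ (-α)`. -/
def Params.loss (S : Params) (χ : Link) : ℝ := S.d χ ^ (-S.α χ)

/-- Path loss of the Alice-RIS-Bob link. -/
def Params.L1 (S : Params) : ℝ := S.loss .RB * S.loss .AR

/-- Path loss of the Alice-RIS-Willie link. -/
def Params.L2 (S : Params) : ℝ := S.loss .RW * S.loss .AR

/-- Path loss of the Jammer-RIS-Bob link. -/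
def Params.L3 (S : Params) : ℝ := S.loss .RB * S.loss .JR

/-- The smaller fading parameter of the two hops of the Alice-RIS-Bob link. -/
def Params.ms (S : Params) : ℝ := min (S.m .AR) (S.m .RB)

/-- The reflection matrix `diag (β e ^ (i θ₁), …, β e ^ (i θ_N))`. -/
def reflection {N : ℕ} (β : ℝ) (θ : Fin N → ℝ) : Matrix (Fin N) (Fin N) ℂ :=
  Matrix.diagonal fun n => (β : ℂ) * Complex.exp (Complex.I * (θ n : ℂ))

/-- The cascaded channel gain `|gᵀ Θ h| ^ 2` from the source with channel `h` to the RIS, and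
from the RIS to the receiver with channel `g`. -/
def gain {N : ℕ} (β : ℝ) (θ : Fin N → ℝ) (g h : Fin N → ℂ) : ℝ :=
  ‖dotProduct g (Matrix.mulVec (reflection β θ) h)‖ ^ 2

/-- The random quantities of the system on a probability space: the fading coefficients, the
jammer's power as a fraction of its maximum, and the phase shifts of the RIS. -/
structure Channel (S : Params) {Ω : Type*} [MeasurableSpace Ω] (P : Measure Ω) where
  /-- fading coefficient of each link at each reflecting element -/
  h : Link → Fin S.N → Ω → ℂ
  /-- the jammer's power divided by its maximal power -/
  U : Ω → ℝ
  /-- phase shifts of the RIS -/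
  θ : Ω → Fin S.N → ℝ
  measurable_h : ∀ χ n, Measurable (h χ n)
  measurable_U : Measurable U
  measurable_θ : Measurable θ
  /-- the amplitudes are Nakagami with the parameter of the link and unit second moment; no
  distribution is prescribed for the complex arguments -/
  nakagami : ∀ χ n, HasLaw (fun ω => ‖h χ n ω‖) (nakagamiMeasure (S.m χ) 1) P
  /-- all fading coefficients are mutually independent -/
  indep : iIndepFun (fun p : Link × Fin S.N => h p.1 p.2) P
  /-- the jammer's power is uniform between zero and its maximum -/
  uniform_U : HasLaw U (volume.restrict (Set.Icc (0 : ℝ) 1)) P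
  /-- the jammer's power is independent of the fading -/
  indep_U : IndepFun U (fun ω (p : Link × Fin S.N) => h p.1 p.2 ω) P
  /-- the phase shifts maximize the gain of the Alice-RIS-Bob link -/
  optimal : ∀ ω (φ : Fin S.N → ℝ),
    gain S.β φ (fun n => h .RB n ω) (fun n => h .AR n ω) ≤
      gain S.β (θ ω) (fun n => h .RB n ω) (fun n => h .AR n ω)

variable {S : Params} {Ω : Type*} [MeasurableSpace Ω] {P : Measure Ω}

/-- Gain of the Alice-RIS-Bob link. -/
def Channel.gainARB (C : Channel S P) (ω : Ω) : ℝ :=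
  gain S.β (C.θ ω) (fun n => C.h .RB n ω) (fun n => C.h .AR n ω)

/-- Gain of the Alice-RIS-Willie link. -/
def Channel.gainARW (C : Channel S P) (ω : Ω) : ℝ :=
  gain S.β (C.θ ω) (fun n => C.h .RW n ω) (fun n => C.h .AR n ω)

/-- Gain of the Jammer-RIS-Bob link. -/
def Channel.gainJRB (C : Channel S P) (ω : Ω) : ℝ :=
  gain S.β (C.θ ω) (fun n => C.h .RB n ω) (fun n => C.h .JR n ω)

/-- Bob's SINR in secrecy mode at total power `Pt`. -/
def Channel.sinrBobSC (C : Channel S P) (Pt : ℝ) (ω : Ω) : ℝ :=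
  Pt * C.gainARB ω * S.L1 / S.σB ^ 2

/-- Willie's SINR in secrecy mode at total power `Pt`, when the gain of the Alice-RIS-Willie
link is `w`. -/
def Params.sinrWillieSC (S : Params) (Pt w : ℝ) : ℝ :=
  Pt * w * S.L2 / S.σW ^ 2

/-- Bob's SINR in covert mode at total power `Pt`, with interference-cancellation coefficient
`r`: Alice's power is `κ Pt` and the jammer's maximal power is `Pt - κ Pt`. -/
def Channel.sinrBobCC (C : Channel S P) (r Pt : ℝ) (ω : Ω) : ℝ :=
  S.κ * Pt * C.gainARB ω * S.L1 /
    (r * ((Pt - S.κ * Pt) * C.U ω) * C.gainJRB ω * S.L3 + S.σB ^ 2)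

/-- The rate of a channel of bandwidth `B` with the given SINR. -/
def Params.rate (S : Params) (sinr : ℝ) : ℝ := S.B * Real.logb 2 (1 + sinr)

/-- The secrecy rate when the gain of the Alice-RIS-Willie link is `w`. -/
def Channel.secrecyRate (C : Channel S P) (Pt w : ℝ) (ω : Ω) : ℝ :=
  max (S.rate (C.sinrBobSC Pt ω) - S.rate (S.sinrWillieSC Pt w)) 0

/-- The covert rate; the interference of the jammer at Bob is cancelled completely. -/
def Channel.covertRate (C : Channel S P) (Pt : ℝ) (ω : Ω) : ℝ :=
  S.rate (C.sinrBobCC 0 Pt ω)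

open Classical in
/-- Bob's rate in the switching system: the system is in secrecy mode if the secrecy rate reaches
the switch threshold, and in covert mode otherwise. -/
def Channel.bobRate (C : Channel S P) (Pt w : ℝ) (ω : Ω) : ℝ :=
  if S.Rbar ≤ C.secrecyRate Pt w ω then C.secrecyRate Pt w ω else C.covertRate Pt ω

/-- Bob's outage probability at transmit SNR `ρ = Pt / σB ^ 2`, when the (random) gain of the
Alice-RIS-Willie link is `W`. -/
def Channel.outageProb (C : Channel S P) (W : Ω → ℝ) (ρ : ℝ) : ℝ :=
  P.real {ω | C.bobRate (ρ * S.σB ^ 2) (W ω) ω < S.Rbar}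

/-- An outage probability, as a function of the transmit SNR, has diversity order `D`:
it is positive at high SNR and `-log p(ρ) / log ρ → D` as `ρ → ∞`. -/
def HasDiversityOrder (p : ℝ → ℝ) (D : ℝ) : Prop :=
  (∀ᶠ ρ in atTop, 0 < p ρ) ∧
    Tendsto (fun ρ => -Real.log (p ρ) / Real.log ρ) atTop (𝓝 D)

end JSACC

end

namespace JSACC

open scoped ENNReal

/-! The optimal phases align all summands, so Bob's gain is `β ^ 2` times the square of `∑ |h_RB|
|h_AR|` (`Channel.gainARB_eq`). Willie's gain matters only through being nonnegative: an outage
forces the covert SINR below the threshold, and is forced as soon as Bob's own secrecy-mode SINR is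
below it. Both are events that the sum is less than a constant times `ρ ^ (-1/2)`, so everything
reduces to the distribution function of the sum near `0`.

From below (`exists_le_measureReal_sum_mul_lt`), the sum is less than `ε` if all amplitudes of the
weaker hop are below `ε / N` and the others below `1`; by independence this has probability of order
`ε ^ (2 m_s N)`. From above (`exists_measureReal_sum_mul_lt_le`), Markov's inequality for the
negative moment of order `s < 2 m_s` of all amplitudes gives `ε ^ (s N)`. The loss in the exponent
is arbitrarily small, hence invisible in the limit, and it spares a separate treatment of equal
fading parameters. -/

/-- A function between `c ρ ^ (-D)` and, for every `D' < D`, `C ρ ^ (-D')` has diversity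
order `D`. -/
theorem hasDiversityOrder_of_bounds {p : ℝ → ℝ} {D : ℝ} (hD : 0 < D)
    (hl : ∃ c > 0, ∀ᶠ ρ in atTop, c * ρ ^ (-D) ≤ p ρ)
    (hu : ∀ D', 0 < D' → D' < D → ∃ C, ∀ᶠ ρ in atTop, p ρ ≤ C * ρ ^ (-D')) :
    HasDiversityOrder p D := by
  obtain ⟨c, hc, hl⟩ := hl
  have hpos : ∀ᶠ ρ in atTop, 0 < p ρ := by
    filter_upwards [hl, eventually_gt_atTop 0] with ρ h hρ
    exact (mul_pos hc (Real.rpow_pos_of_pos hρ _)).trans_le h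
  have hlim (E c : ℝ) : Tendsto (fun ρ => E - Real.log c / Real.log ρ) atTop (𝓝 E) := by
    simpa using tendsto_const_nhds.sub (Real.tendsto_log_atTop.const_div_atTop (Real.log c))
  refine ⟨hpos, tendsto_order.2 ⟨fun a ha => ?_, fun a ha => ?_⟩⟩
  -- The maximum with `0` keeps `D'` positive when `a` is negative.
  · obtain ⟨D', hD', hD'D⟩ := exists_between (max_lt ha hD)
    obtain ⟨C, hC⟩ := hu D' ((le_max_right _ _).trans_lt hD') hD'D
    filter_upwards [hC, hpos, eventually_gt_atTop 1,
      (hlim D' C).eventually_const_lt ((le_max_left _ _).trans_lt hD')] with ρ h hp hρ hlt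
    refine hlt.trans_le ?_
    have hρ0 : 0 < ρ := one_pos.trans hρ
    have hlog := Real.log_pos hρ
    have hC0 : 0 < C := pos_of_mul_pos_left (hp.trans_le h) (Real.rpow_pos_of_pos hρ0 _).le
    have h2 := Real.log_le_log hp h
    rw [Real.log_mul hC0.ne' (Real.rpow_pos_of_pos hρ0 _).ne', Real.log_rpow hρ0] at h2
    rw [le_div_iff₀ hlog, sub_mul, div_mul_cancel₀ _ hlog.ne']
    linarith
  · filter_upwards [hl, eventually_gt_atTop 1, (hlim D c).eventually_lt_const ha]
      with ρ h hρ hlt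
    refine lt_of_le_of_lt ?_ hlt
    have hρ0 : 0 < ρ := one_pos.trans hρ
    have hlog := Real.log_pos hρ
    have h2 := Real.log_le_log (mul_pos hc (Real.rpow_pos_of_pos hρ0 _)) h
    rw [Real.log_mul hc.ne' (Real.rpow_pos_of_pos hρ0 _).ne', Real.log_rpow hρ0] at h2
    rw [div_le_iff₀ hlog, sub_mul, div_mul_cancel₀ _ hlog.ne']
    linarith

/-! ### The Nakagami distribution near zero -/

theorem measurable_nakagamiPDF (m w : ℝ) : Measurable (nakagamiPDF m w) := by
  unfold nakagamiPDF
  exact Measurable.ite measurableSet_Ioi (by fun_prop) measurable_const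

/-- On `(0, 1]` the exponential factor is at least `exp (-m)`, so the density dominates a multiple
of `x ^ (2 * m - 1)`, which is integrated explicitly. -/
theorem exists_le_nakagamiMeasure_Iio {m : ℝ} (hm : 0 < m) :
    ∃ c > 0, ∀ δ, 0 < δ → δ ≤ 1 →
      ENNReal.ofReal (c * δ ^ (2 * m)) ≤ nakagamiMeasure m 1 (Set.Iio δ) := by
  have hΓ := Real.Gamma_pos_of_pos hm
  have hmm := Real.rpow_pos_of_pos hm m
  set K := 2 * m ^ m / (Real.Gamma m * 1 ^ m) * Real.exp (-m) with hK
  have hK0 : 0 < K := by rw [hK, Real.one_rpow]; positivity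
  refine ⟨K / (2 * m), by positivity, fun δ hδ hδ1 => ?_⟩
  have hint : IntegrableOn (fun x : ℝ => K * x ^ (2 * m - 1)) (Set.Ioc 0 δ) :=
    ((intervalIntegral.intervalIntegrable_rpow' (by linarith)).const_mul K).1
  calc ENNReal.ofReal (K / (2 * m) * δ ^ (2 * m))
      = ENNReal.ofReal (∫ x in Set.Ioc 0 δ, K * x ^ (2 * m - 1)) := by
        rw [← intervalIntegral.integral_of_le hδ.le, intervalIntegral.integral_const_mul,
          integral_rpow (Or.inl (by linarith)), Real.zero_rpow (by linarith)]
        congr 1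
        rw [sub_add_cancel]
        ring
    _ = ∫⁻ x in Set.Ioc 0 δ, ENNReal.ofReal (K * x ^ (2 * m - 1)) :=
        ofReal_integral_eq_lintegral_ofReal hint <|
          (ae_restrict_iff' measurableSet_Ioc).2 <| ae_of_all _ fun x hx =>
            mul_nonneg hK0.le (Real.rpow_nonneg hx.1.le _)
    _ ≤ ∫⁻ x in Set.Ioc 0 δ, ENNReal.ofReal (nakagamiPDF m 1 x) := by
        refine setLIntegral_mono (measurable_nakagamiPDF m 1).ennreal_ofReal fun x hx => ?_
        refine ENNReal.ofReal_le_ofReal ?_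
        rw [nakagamiPDF, if_pos hx.1, hK, mul_right_comm]
        gcongr
        · exact mul_nonneg (by rw [Real.one_rpow]; positivity) (Real.rpow_nonneg hx.1.le _)
        · have : x ^ 2 ≤ 1 := pow_le_one₀ hx.1.le (hx.2.trans hδ1)
          rw [div_one]
          nlinarith
    _ = ∫⁻ x in Set.Ioo 0 δ, ENNReal.ofReal (nakagamiPDF m 1 x) := by
        rw [setLIntegral_congr Ioo_ae_eq_Ioc]
    _ ≤ ∫⁻ x in Set.Iio δ, ENNReal.ofReal (nakagamiPDF m 1 x) :=
        lintegral_mono_set fun x hx => hx.2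
    _ = nakagamiMeasure m 1 (Set.Iio δ) := by
        rw [nakagamiMeasure, withDensity_apply _ measurableSet_Iio]

/-- The integrand behaves like `x ^ (2 * m - 1 - s)` at `0`, with exponent above `-1`, and has a
Gaussian tail. -/
theorem lintegral_rpow_neg_nakagamiMeasure_ne_top {m s : ℝ} (hm : 0 < m) (hs : s < 2 * m) :
    ∫⁻ x, ENNReal.ofReal x ^ (-s) ∂nakagamiMeasure m 1 ≠ ∞ := by
  rw [nakagamiMeasure, lintegral_withDensity_eq_lintegral_mul _
    (measurable_nakagamiPDF m 1).ennreal_ofReal (by fun_prop)]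
  have hint : IntegrableOn (fun x : ℝ => 2 * m ^ m / (Real.Gamma m * 1 ^ m) *
      (x ^ (2 * m - 1 - s) * Real.exp (-m * x ^ 2))) (Set.Ioi 0) :=
    (integrableOn_rpow_mul_exp_neg_mul_sq hm (by linarith)).const_mul _
  refine ne_of_eq_of_ne ?_ hint.lintegral_lt_top.ne
  rw [← lintegral_indicator measurableSet_Ioi]
  refine lintegral_congr fun x => ?_
  by_cases hx : 0 < x
  · rw [Set.indicator_of_mem (Set.mem_Ioi.2 hx), Pi.mul_apply,
      ENNReal.ofReal_rpow_of_pos hx,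
      ← ENNReal.ofReal_mul' (Real.rpow_nonneg hx.le _), nakagamiPDF, if_pos hx, div_one,
      sub_eq_add_neg _ s, Real.rpow_add hx]
    congr 1
    ring
  -- The power may be `∞` here, but the density vanishes and `0 * ∞ = 0`.
  · rw [Set.indicator_of_notMem (by simpa using hx), Pi.mul_apply, nakagamiPDF, if_neg hx]
    simp

/-! ### Sums of products of independent amplitudes -/

section Sum

variable {ι Ω : Type*} [Fintype ι] [MeasurableSpace Ω] {P : Measure Ω}

/-- Markov's inequality, for a negative moment, for a sum of products of independent nonnegative
variables. -/
theorem measure_sum_mul_lt_le {Z : ι × Bool → Ω → ℝ} (hZ : ∀ p, Measurable (Z p))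
    (h0 : ∀ p ω, 0 ≤ Z p ω) (hind : iIndepFun Z P) {s ε : ℝ} (hs : 0 ≤ s) (hε : 0 < ε) :
    P {ω | ∑ i, Z (i, true) ω * Z (i, false) ω < ε} ≤
      ENNReal.ofReal (ε ^ (s * Fintype.card ι)) *
        ∏ p, ∫⁻ ω, ENNReal.ofReal (Z p ω) ^ (-s) ∂P := by
  have hmeas (p) : Measurable fun ω => ENNReal.ofReal (Z p ω) ^ (-s) :=
    (hZ p).ennreal_ofReal.pow_const _
  have hprod : ∫⁻ ω, ∏ p, ENNReal.ofReal (Z p ω) ^ (-s) ∂P =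
      ∏ p, ∫⁻ ω, ENNReal.ofReal (Z p ω) ^ (-s) ∂P :=
    lintegral_prod_eq_prod_lintegral_of_indepFun Finset.univ
      (fun p ω => ENNReal.ofReal (Z p ω) ^ (-s))
      (hind.comp (fun _ x => ENNReal.ofReal x ^ (-s)) fun _ => by fun_prop) hmeas
  have hsub : {ω | ∑ i, Z (i, true) ω * Z (i, false) ω < ε} ⊆
      -- Each summand is at most the whole sum, hence below `ε`; the negative power reverses this,
      -- and the bounds multiply over `ι`.
      {ω | (ENNReal.ofReal ε ^ (-s)) ^ Fintype.card ι ≤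
        ∏ p, ENNReal.ofReal (Z p ω) ^ (-s)} := fun ω hω => by
    rw [Set.mem_ofPred_eq, Fintype.prod_prod_type, ← Finset.card_univ, ← Finset.prod_const]
    refine Finset.prod_le_prod' fun i _ => ?_
    rw [Fintype.prod_bool, ← ENNReal.mul_rpow_of_ne_top ENNReal.ofReal_ne_top
      ENNReal.ofReal_ne_top, ← ENNReal.ofReal_mul (h0 _ _)]
    rw [ENNReal.rpow_neg, ENNReal.rpow_neg, ENNReal.inv_le_inv]
    refine ENNReal.rpow_le_rpow (ENNReal.ofReal_le_ofReal ?_) hs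
    exact (Finset.single_le_sum (f := fun i => Z (i, true) ω * Z (i, false) ω)
      (fun i _ => mul_nonneg (h0 _ _) (h0 _ _)) (Finset.mem_univ i)).trans (le_of_lt hω)
  have hmk := mul_meas_ge_le_lintegral (μ := P)
    (Finset.measurable_fun_prod Finset.univ fun p _ => hmeas p)
    ((ENNReal.ofReal ε ^ (-s)) ^ Fintype.card ι)
  rw [hprod] at hmk
  calc P {ω | ∑ i, Z (i, true) ω * Z (i, false) ω < ε}
      ≤ P {ω | (ENNReal.ofReal ε ^ (-s)) ^ Fintype.card ι ≤
        ∏ p, ENNReal.ofReal (Z p ω) ^ (-s)} := measure_mono hsub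
    _ = ENNReal.ofReal (ε ^ (s * Fintype.card ι)) *
        ((ENNReal.ofReal ε ^ (-s)) ^ Fintype.card ι *
        P {ω | (ENNReal.ofReal ε ^ (-s)) ^ Fintype.card ι ≤
          ∏ p, ENNReal.ofReal (Z p ω) ^ (-s)}) := by
        rw [← mul_assoc, ENNReal.ofReal_rpow_of_pos hε, ← ENNReal.ofReal_pow (by positivity),
          ← ENNReal.ofReal_mul (by positivity), ← Real.rpow_natCast (ε ^ (-s)),
          ← Real.rpow_mul hε.le, ← Real.rpow_add hε, neg_mul, add_neg_cancel, Real.rpow_zero,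
          ENNReal.ofReal_one, one_mul]
    _ ≤ _ := by gcongr

/-- Near zero, the distribution function of a sum of products of independent Nakagami variables
is at least of the order given by the fading parameter of either factor. -/
theorem exists_le_measureReal_sum_mul_lt [Nonempty ι] [IsProbabilityMeasure P]
    {Z : ι × Bool → Ω → ℝ} {m : Bool → ℝ}
    (hm : ∀ b, 0 < m b) (hZ : ∀ p, HasLaw (Z p) (nakagamiMeasure (m p.2) 1) P)
    (h0 : ∀ p ω, 0 ≤ Z p ω) (hind : iIndepFun Z P) (b : Bool) :
    ∃ c > 0, ∀ ε, 0 < ε → ε ≤ 1 → c * ε ^ (2 * m b * Fintype.card ι) ≤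
      P.real {ω | ∑ i, Z (i, true) ω * Z (i, false) ω < ε} := by
  have hlaw (p) (δ : ℝ) : P (Z p ⁻¹' Set.Iio δ) = nakagamiMeasure (m p.2) 1 (Set.Iio δ) :=
    (hZ p).measure_eq (p := fun x => x < δ) measurableSet_Iio
  have key (p) : ∃ c > 0, ∀ δ, 0 < δ → δ ≤ 1 →
      c * δ ^ (2 * m p.2) ≤ P.real (Z p ⁻¹' Set.Iio δ) := by
    obtain ⟨c, hc, h⟩ := exists_le_nakagamiMeasure_Iio (hm p.2)
    refine ⟨c, hc, fun δ hδ hδ1 => ?_⟩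
    rw [Measure.real, ← ENNReal.ofReal_le_iff_le_toReal (measure_ne_top _ _), hlaw]
    exact h δ hδ hδ1
  choose c hc hcle using key
  have hN : (0 : ℝ) < Fintype.card ι := Nat.cast_pos.2 Fintype.card_pos
  have hN1 : (1 : ℝ) ≤ Fintype.card ι := Nat.one_le_cast.2 Fintype.card_pos
  set N : ℝ := (Fintype.card ι : ℝ) with hNdef
  -- Hop `b` alone is made small; bounding the other by `1` costs only a constant and makes each
  -- product less than `ε / N`.
  set t : ι × Bool → ℝ → ℝ := fun p ε => if p.2 = b then ε / N else 1 with ht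
  refine ⟨∏ i, (c (i, b) * (1 / N) ^ (2 * m b) * c (i, !b)), Finset.prod_pos fun i _ => by
    have := hc (i, b); have := hc (i, !b); positivity, fun ε hε hε1 => ?_⟩
  have ht0 (p) : 0 < t p ε := by rw [ht]; dsimp only; split_ifs <;> positivity
  have ht1 (p) : t p ε ≤ 1 := by
    rw [ht]; dsimp only; split_ifs
    · exact (div_le_one hN).2 (hε1.trans hN1)
    · exact le_rfl
  calc _ = ∏ p, c p * t p ε ^ (2 * m p.2) := by
        have hpow : ε ^ (2 * m b * N) = ∏ _i : ι, ε ^ (2 * m b) := by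
          rw [Finset.prod_const, Finset.card_univ, hNdef, Real.rpow_mul_natCast hε.le]
        have hdiv : (ε / N) ^ (2 * m b) = ε ^ (2 * m b) * (1 / N) ^ (2 * m b) := by
          rw [div_eq_mul_one_div, Real.mul_rpow hε.le (by positivity)]
        rw [Fintype.prod_prod_type, hpow, ← Finset.prod_mul_distrib]
        refine Finset.prod_congr rfl fun i _ => ?_
        rw [Fintype.prod_bool]
        cases b
        · rw [show t (i, true) ε = 1 from if_neg (by simp),
            show t (i, false) ε = ε / N from if_pos rfl, hdiv, Real.one_rpow, Bool.not_false]
          ring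
        · rw [show t (i, true) ε = ε / N from if_pos rfl,
            show t (i, false) ε = 1 from if_neg (by simp), hdiv, Real.one_rpow, Bool.not_true]
          ring
    _ ≤ ∏ p, P.real (Z p ⁻¹' Set.Iio (t p ε)) := by
        refine Finset.prod_le_prod (fun p _ => ?_) fun p _ => hcle p _ (ht0 p) (ht1 p)
        have := hc p; have := ht0 p; positivity
    _ = P.real (⋂ p ∈ Finset.univ, Z p ⁻¹' Set.Iio (t p ε)) := by
        rw [Measure.real, hind.measure_inter_preimage_eq_mul _ fun _ _ => measurableSet_Iio,
          ENNReal.toReal_prod]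
        rfl
    _ ≤ _ := by
        refine measureReal_mono fun ω hω => ?_
        simp only [Finset.mem_univ, Set.iInter_true, Set.mem_iInter, Set.mem_preimage,
          Set.mem_Iio] at hω
        have hlt : ∑ i, Z (i, true) ω * Z (i, false) ω < ∑ _i : ι, ε / N := by
          refine Finset.sum_lt_sum_of_nonempty Finset.univ_nonempty fun i _ => ?_
          refine (mul_lt_mul'' (hω _) (hω _) (h0 _ _) (h0 _ _)).trans_eq ?_
          rw [ht]
          cases b <;> simp
        rw [Finset.sum_const, Finset.card_univ, nsmul_eq_mul, mul_div_cancel₀ _ hN.ne'] at hlt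
        exact hlt

theorem exists_measureReal_sum_mul_lt_le {Z : ι × Bool → Ω → ℝ} {m : Bool → ℝ}
    (hm : ∀ b, 0 < m b) (hmeas : ∀ p, Measurable (Z p))
    (hZ : ∀ p, HasLaw (Z p) (nakagamiMeasure (m p.2) 1) P)
    (h0 : ∀ p ω, 0 ≤ Z p ω) (hind : iIndepFun Z P) {s : ℝ} (hs : 0 ≤ s)
    (hsm : ∀ b, s < 2 * m b) :
    ∃ C, ∀ ε, 0 < ε →
      P.real {ω | ∑ i, Z (i, true) ω * Z (i, false) ω < ε} ≤
        C * ε ^ (s * Fintype.card ι) := by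
  have hfin : ∏ p, ∫⁻ ω, ENNReal.ofReal (Z p ω) ^ (-s) ∂P ≠ ∞ := by
    refine ENNReal.prod_ne_top fun p _ => ?_
    rw [(hZ p).lintegral_comp (f := fun x => ENNReal.ofReal x ^ (-s)) (by fun_prop)]
    exact lintegral_rpow_neg_nakagamiMeasure_ne_top (hm _) (hsm _)
  refine ⟨(∏ p, ∫⁻ ω, ENNReal.ofReal (Z p ω) ^ (-s) ∂P).toReal, fun ε hε => ?_⟩
  have h := ENNReal.toReal_mono (ENNReal.mul_ne_top ENNReal.ofReal_ne_top hfin)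
    (measure_sum_mul_lt_le hmeas h0 hind hs hε)
  rwa [ENNReal.toReal_mul, ENNReal.toReal_ofReal (by positivity), mul_comm] at h

end Sum

/-! ### The gain under optimal phases -/

theorem dotProduct_reflection_mulVec {N : ℕ} (β : ℝ) (θ : Fin N → ℝ) (g h : Fin N → ℂ) :
    dotProduct g (Matrix.mulVec (reflection β θ) h) =
      ∑ n, g n * (β * Complex.exp (Complex.I * θ n) * h n) := by
  simp [dotProduct, reflection, Matrix.mulVec_diagonal]

theorem gain_le {N : ℕ} {β : ℝ} (hβ : 0 ≤ β) (θ : Fin N → ℝ) (g h : Fin N → ℂ) :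
    gain β θ g h ≤ β ^ 2 * (∑ n, ‖g n‖ * ‖h n‖) ^ 2 := by
  rw [gain, ← mul_pow, dotProduct_reflection_mulVec, Finset.mul_sum]
  gcongr
  refine (norm_sum_le _ _).trans_eq (Finset.sum_congr rfl fun n _ => ?_)
  rw [norm_mul, norm_mul, norm_mul, Complex.norm_real, Real.norm_of_nonneg hβ,
    mul_comm Complex.I, Complex.norm_exp_ofReal_mul_I]
  ring

/-- The gain is largest when the phase shifts compensate the phases of the channels. -/
theorem gain_neg_arg {N : ℕ} (β : ℝ) (g h : Fin N → ℂ) :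
    gain β (fun n => -((g n).arg + (h n).arg)) g h =
      β ^ 2 * (∑ n, ‖g n‖ * ‖h n‖) ^ 2 := by
  have key : dotProduct g (Matrix.mulVec (reflection β fun n => -((g n).arg + (h n).arg)) h) =
      ((β * ∑ n, ‖g n‖ * ‖h n‖ : ℝ) : ℂ) := by
    rw [dotProduct_reflection_mulVec, Finset.mul_sum, Complex.ofReal_sum]
    refine Finset.sum_congr rfl fun n _ => ?_
    have hexp : Complex.exp ((g n).arg * Complex.I) * Complex.exp ((h n).arg * Complex.I) *
        Complex.exp (Complex.I * ((-((g n).arg + (h n).arg) : ℝ) : ℂ)) = 1 := by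
      rw [← Complex.exp_add, ← Complex.exp_add, ← Complex.exp_zero]
      congr 1
      push_cast
      ring
    calc _ = ‖g n‖ * Complex.exp ((g n).arg * Complex.I) *
          (β * Complex.exp (Complex.I * ((-((g n).arg + (h n).arg) : ℝ) : ℂ)) *
          (‖h n‖ * Complex.exp ((h n).arg * Complex.I))) := by
          rw [Complex.norm_mul_exp_arg_mul_I, Complex.norm_mul_exp_arg_mul_I]
      _ = ((β * (‖g n‖ * ‖h n‖) : ℝ) : ℂ) := by
          rw [Complex.ofReal_mul, Complex.ofReal_mul]
          linear_combination (β * (‖g n‖ * ‖h n‖) : ℂ) * hexp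
  rw [gain, key, Complex.norm_real, Real.norm_eq_abs, sq_abs, mul_pow]

/-! ### Outage as an event about Bob's gain -/

theorem Params.loss_pos (S : Params) (χ : Link) : 0 < S.loss χ :=
  Real.rpow_pos_of_pos (S.d_pos χ) _

theorem Params.L1_pos (S : Params) : 0 < S.L1 := mul_pos (S.loss_pos _) (S.loss_pos _)

theorem Params.L2_pos (S : Params) : 0 < S.L2 := mul_pos (S.loss_pos _) (S.loss_pos _)

/-- The SINR at which the rate is the target rate. -/
noncomputable def Params.threshold (S : Params) : ℝ := 2 ^ (S.Rbar / S.B) - 1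

theorem Params.threshold_pos (S : Params) : 0 < S.threshold :=
  sub_pos.2 <| Real.one_lt_rpow one_lt_two (div_pos S.Rbar_pos S.B_pos)

theorem Params.rate_lt_Rbar_iff (S : Params) {x : ℝ} (hx : 0 ≤ x) :
    S.rate x < S.Rbar ↔ x < S.threshold := by
  rw [Params.rate, mul_comm, ← lt_div_iff₀ S.B_pos,
    Real.logb_lt_iff_lt_rpow one_lt_two (by linarith), Params.threshold, lt_sub_iff_add_lt']

theorem Params.rate_nonneg (S : Params) {x : ℝ} (hx : 0 ≤ x) : 0 ≤ S.rate x :=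
  mul_nonneg S.B_pos.le (Real.logb_nonneg one_lt_two (by linarith))

variable {S : Params} {Ω : Type*} [MeasurableSpace Ω] {P : Measure Ω} (C : Channel S P)

theorem Channel.gainARB_eq (ω : Ω) :
    C.gainARB ω = S.β ^ 2 * (∑ n, ‖C.h .RB n ω‖ * ‖C.h .AR n ω‖) ^ 2 :=
  (gain_le S.β_pos.le _ _ _).antisymm ((gain_neg_arg _ _ _).symm.trans_le (C.optimal ω _))

theorem Channel.gainARB_nonneg (ω : Ω) : 0 ≤ C.gainARB ω := sq_nonneg _

theorem Channel.sinrBobSC_eq (ρ : ℝ) (ω : Ω) :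
    C.sinrBobSC (ρ * S.σB ^ 2) ω = ρ * (C.gainARB ω * S.L1) := by
  have := S.σB_pos.ne'
  rw [Channel.sinrBobSC]
  field_simp

theorem Channel.sinrBobCC_zero_eq (ρ : ℝ) (ω : Ω) :
    C.sinrBobCC 0 (ρ * S.σB ^ 2) ω = S.κ * (ρ * (C.gainARB ω * S.L1)) := by
  have := S.σB_pos.ne'
  rw [Channel.sinrBobCC, zero_mul, zero_mul, zero_mul, zero_add]
  field_simp

theorem Channel.snr_nonneg {ρ : ℝ} (hρ : 0 ≤ ρ) (ω : Ω) : 0 ≤ ρ * (C.gainARB ω * S.L1) :=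
  mul_nonneg hρ (mul_nonneg (C.gainARB_nonneg ω) S.L1_pos.le)

/-- The switching rule excludes outage in secrecy mode, so the covert rate is the one that fails. -/
theorem Channel.lt_threshold_of_bobRate_lt {ρ w : ℝ} (hρ : 0 ≤ ρ) {ω : Ω}
    (h : C.bobRate (ρ * S.σB ^ 2) w ω < S.Rbar) :
    S.κ * (ρ * (C.gainARB ω * S.L1)) < S.threshold := by
  rw [Channel.bobRate] at h
  split_ifs at h with hs
  · exact absurd hs h.not_ge
  · rwa [Channel.covertRate, C.sinrBobCC_zero_eq,
      S.rate_lt_Rbar_iff (mul_nonneg S.κ_pos.le (C.snr_nonneg hρ ω))] at h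

/-- Both modes fail: Willie's rate can only lower the secrecy rate, and covert mode has only the
fraction `κ < 1` of the power. -/
theorem Channel.bobRate_lt {ρ w : ℝ} (hρ : 0 ≤ ρ) (hw : 0 ≤ w) {ω : Ω}
    (h : ρ * (C.gainARB ω * S.L1) < S.threshold) :
    C.bobRate (ρ * S.σB ^ 2) w ω < S.Rbar := by
  have h0 := C.snr_nonneg hρ ω
  rw [Channel.bobRate]
  split_ifs
  · refine max_lt ?_ S.Rbar_pos
    have h1 : S.rate (C.sinrBobSC (ρ * S.σB ^ 2) ω) < S.Rbar := by
      rwa [C.sinrBobSC_eq, S.rate_lt_Rbar_iff h0]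
    have h2 : 0 ≤ S.rate (S.sinrWillieSC (ρ * S.σB ^ 2) w) := by
      have := S.L2_pos.le
      exact S.rate_nonneg (by rw [Params.sinrWillieSC]; positivity)
    linarith
  · rw [Channel.covertRate, C.sinrBobCC_zero_eq,
      S.rate_lt_Rbar_iff (mul_nonneg S.κ_pos.le h0)]
    exact (mul_le_of_le_one_left h0 S.κ_lt_one.le).trans_lt h

/-! ### Diversity order of the outage probability -/

/-- The amplitude of the fading towards Bob: the second hop for `true`, the first for `false`. -/
noncomputable def Channel.amplitude (p : Fin S.N × Bool) (ω : Ω) : ℝ :=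
  ‖C.h (if p.2 then .RB else .AR) p.1 ω‖

theorem Channel.measurable_amplitude (p : Fin S.N × Bool) : Measurable (C.amplitude p) :=
  (C.measurable_h _ _).norm

theorem Channel.iIndepFun_amplitude : iIndepFun C.amplitude P := by
  have hinj : Function.Injective fun p : Fin S.N × Bool =>
      ((if p.2 then .RB else .AR, p.1) : Link × Fin S.N) := by
    rintro ⟨i, _ | _⟩ ⟨j, _ | _⟩ h <;> simp_all
  exact (C.indep.precomp hinj).comp (fun _ z => ‖z‖) fun _ => measurable_norm

theorem Channel.gainARB_lt_iff (x : ℝ) (ω : Ω) :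
    C.gainARB ω < x ↔
      ∑ i, C.amplitude (i, true) ω * C.amplitude (i, false) ω < √x / S.β := by
  have hA : 0 ≤ ∑ n, ‖C.h .RB n ω‖ * ‖C.h .AR n ω‖ := by positivity
  rw [C.gainARB_eq, ← mul_pow, ← Real.lt_sqrt (mul_nonneg S.β_pos.le hA), lt_div_iff₀' S.β_pos]
  simp [Channel.amplitude]

/-- The square root, present because the gain is a squared amplitude sum, turns the exponent `2 * a
* n` in `ε` into `a * n` in `ρ`. -/
theorem sqrt_div_rpow {k ρ β : ℝ} (hk : 0 < k) (hρ : 0 < ρ) (hβ : 0 < β) (a n : ℝ) :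
    (√(k / ρ) / β) ^ (2 * a * n) = (√k / β) ^ (2 * a * n) * ρ ^ (-(a * n)) := by
  rw [Real.sqrt_div hk.le, div_right_comm, Real.div_rpow (by positivity) (by positivity),
    Real.sqrt_eq_rpow ρ, ← Real.rpow_mul hρ.le, Real.rpow_neg hρ.le, div_eq_mul_inv]
  congr 3
  ring

theorem Channel.hasDiversityOrder_outageProb [IsProbabilityMeasure P] {W : Ω → ℝ}
    (hW : ∀ᵐ ω ∂P, 0 ≤ W ω) :
    HasDiversityOrder (C.outageProb W) (S.ms * S.N) := by
  have : Nonempty (Fin S.N) := ⟨⟨0, S.N_pos⟩⟩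
  have hN : (0 : ℝ) < S.N := Nat.cast_pos.2 S.N_pos
  set m : Bool → ℝ := fun b => S.m (if b then .RB else .AR) with hm_def
  have hm (b) : 0 < m b := S.m_pos _
  have hlaw (p : Fin S.N × Bool) :
      HasLaw (C.amplitude p) (nakagamiMeasure (m p.2) 1) P := C.nakagami _ _
  have h0 (p : Fin S.N × Bool) (ω : Ω) : 0 ≤ C.amplitude p ω := norm_nonneg _
  have hms (b) : S.ms ≤ m b := by cases b <;> simp [hm_def, Params.ms]
  obtain ⟨b, hb⟩ : ∃ b, m b = S.ms := by
    rcases min_choice (S.m .AR) (S.m .RB) with h | h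
    · exact ⟨false, by simp [hm_def, Params.ms, h]⟩
    · exact ⟨true, by simp [hm_def, Params.ms, h]⟩
  have hms0 : 0 < S.ms := hb ▸ hm b
  have ht := S.threshold_pos
  have hL := S.L1_pos
  have hβ := S.β_pos
  have hκ := S.κ_pos
  refine hasDiversityOrder_of_bounds (mul_pos hms0 hN) ?_ fun D' hD' hD'D => ?_
  · obtain ⟨c, hc, hle⟩ := exists_le_measureReal_sum_mul_lt hm hlaw h0 C.iIndepFun_amplitude b
    set k := S.threshold / S.L1
    have hk : 0 < k := div_pos ht hL
    have hlim : Tendsto (fun ρ : ℝ => √(k / ρ) / S.β) atTop (𝓝 0) := by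
      have := ((tendsto_id.const_div_atTop k).sqrt).div_const S.β
      rwa [Real.sqrt_zero, zero_div] at this
    refine ⟨c * (√k / S.β) ^ (2 * S.ms * S.N), by positivity, ?_⟩
    filter_upwards [eventually_gt_atTop 0, hlim.eventually_le_const one_pos] with ρ hρ hρ1
    have h := hle _ (by positivity) hρ1
    rw [hb, Fintype.card_fin, sqrt_div_rpow hk hρ hβ, ← mul_assoc] at h
    refine h.trans (ENNReal.toReal_mono (measure_ne_top _ _) (measure_mono_ae ?_))
    filter_upwards [hW] with ω hω h
    refine C.bobRate_lt hρ.le hω ?_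
    have h := (C.gainARB_lt_iff _ ω).2 h
    rw [lt_div_iff₀ hρ, lt_div_iff₀ hL] at h
    linarith
  · obtain ⟨K, hK⟩ := exists_measureReal_sum_mul_lt_le hm C.measurable_amplitude hlaw h0
      -- This order gives decay exactly `ρ ^ (-D')`; it is admissible because `D' / N < m_s`.
      C.iIndepFun_amplitude (s := 2 * (D' / S.N)) (by positivity) fun b => by
        have := (div_lt_iff₀ hN).2 hD'D
        have := hms b
        linarith
    -- The factor `κ`, absent from the constant of the lower bound, changes only the constant and
    -- not the exponent.
    set k := S.threshold / (S.κ * S.L1)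
    have hk : 0 < k := by positivity
    refine ⟨K * (√k / S.β) ^ (2 * (D' / S.N) * S.N), ?_⟩
    filter_upwards [eventually_gt_atTop 0] with ρ hρ
    have h := hK (√(k / ρ) / S.β) (by positivity)
    rw [Fintype.card_fin, sqrt_div_rpow hk hρ hβ, ← mul_assoc,
      div_mul_cancel₀ _ hN.ne'] at h
    refine le_trans (measureReal_mono fun ω hω => ?_) h
    refine (C.gainARB_lt_iff _ ω).1 ?_
    have h := C.lt_threshold_of_bobRate_lt hρ.le hω
    rw [lt_div_iff₀ hρ, lt_div_iff₀ (by positivity)]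
    linarith

theorem ae_nonneg_expMeasure (r : ℝ) : ∀ᵐ x ∂expMeasure r, 0 ≤ x := by
  simp only [ae_iff, not_le]
  change gammaMeasure 1 r (Set.Iio 0) = 0
  rw [gammaMeasure, withDensity_apply _ measurableSet_Iio]
  exact lintegral_gammaPDF_of_nonpos le_rfl

end JSACC

theorem mainTheorem3 (S : JSACC.Params) {Ω : Type*} [MeasurableSpace Ω]
    (P : MeasureTheory.Measure Ω) [MeasureTheory.IsProbabilityMeasure P]
    (C : JSACC.Channel S P) :
    JSACC.HasDiversityOrder (C.outageProb C.gainARW) (S.ms * S.N) ∧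
    ∀ Y : Ω → ℝ, Measurable Y →
      ProbabilityTheory.HasLaw Y (ProbabilityTheory.expMeasure (1 / (S.N : ℝ))) P →
      ProbabilityTheory.IndepFun Y
        (fun ω (n : Fin S.N) => (C.h .AR n ω, C.h .RB n ω)) P →
      JSACC.HasDiversityOrder (C.outageProb fun ω => S.β ^ 2 * Y ω) (S.ms * S.N) := by
  refine ⟨C.hasDiversityOrder_outageProb (ae_of_all _ fun _ => sq_nonneg _),
    fun Y _ hY _ => C.hasDiversityOrder_outageProb ?_⟩
  have hY0 : ∀ᵐ ω ∂P, 0 ≤ Y ω := by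
    refine ae_of_ae_map hY.aemeasurable ?_
    rw [hY.map_eq]
    exact JSACC.ae_nonneg_expMeasure _
  filter_upwards [hY0] with ω hω
  positivity
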